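/- Let $\mathcal Z$ be a measurable space with a probability distribution $\mathcal D$, let $n\ge 1$, and let $S=(z_1,\dots,z_n)$ be an i.i.d. sample from $\mathcal D$. Let $f(\mathbf w;z)$ and $R(\mathbf w)$, $\mathbf w\in\mathbb R^d$, be an objective and a regularizer which are differentiable in $\mathbf w$, and let $\ell(\mathbf w;z)$ be a loss function ($f$ and $\ell$ jointly measurable). Assume that $|\ell(\mathbf w;z)|\le C$ for all $\mathbf w,z$, and that $\|\nabla f(\mathbf w;z)-\nabla f(\mathbf w;z')\|\le L$ for all $\mathbf w,z,z'$ (gradients with respect to $\mathbf w$). Consider $N$ rounds of SGLD with one-point stochastic gradients, inverse temperature $\beta>0$ and step sizes $\eta_1,\dots,\eta_N>0$, that is, $\mathbf w_0\sim\mathcal N(0,\sigma_0^2 I_d)$ and $$\mathbf w_{k}=\mathbf w_{k-1}-\eta_k\big(\nabla f(\mathbf w_{k-1};z_{i_k})+\nabla R(\mathbf w_{k-1})\big)+\sqrt{\tfrac{2\eta_k}{\beta}}\,\xi_k,\qquad k=1,\dots,N,$$ where the indices $i_k$ are uniform on $\{1,\dots,n\}$, the noises $\xi_k$ have law $\mathcal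 N(0,I_d)$, and $\mathbf w_0$, all $i_k$, all $\xi_k$ and $S$ are independent. Let $\mathrm{err}(\mathbf w_N)=\mathbb E\big[\mathbb E_{z\sim\mathcal D}\,\ell(\mathbf w_N;z)-\frac1n\sum_{i=1}^n\ell(\mathbf w_N;z_i)\,\big|\,S\big]$ be the generalization error, averaged over the randomness of the algorithm. Let $k_0\ge 0$ be an integer such that $\eta_k\,\beta L^2\le\ln 2$ (i.e. $\eta_k\le\frac{\ln 2}{\beta L^2}$ if $L>0$) for all $k_0<k\le N$. Then $\mathrm{err}(\mathbf w_N)$ is an integrable function of $S$ and $$\mathbb E_S[\mathrm{err}(\mathbf w_N)]\le\frac{2Ck_0}{n}+\frac{\sqrt\beta\,L\,C}{n}\Big(\sum_{i=k_0+1}^N\eta_i\Big)^{1/2}.$$ -/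

import Mathlib

open MeasureTheory ProbabilityTheory

noncomputable section

/-- One SGLD update with one-point stochastic gradient and regularizer `R`: from the point `w`,
with step size `η`, inverse temperature `β`, data point `z` and standard Gaussian noise `ξ`,
`w - η (∇f(w; z) + ∇R(w)) + √(2η/β) ξ`. -/
def sgldStep {d : ℕ} {Z : Type*} (f : EuclideanSpace ℝ (Fin d) → Z → ℝ)
    (R : EuclideanSpace ℝ (Fin d) → ℝ) (β η : ℝ) (z : Z) (w ξ : EuclideanSpace ℝ (Fin d)) :
    EuclideanSpace ℝ (Fin d) :=
  w - η • (gradient (fun v => f v z) w + gradient R w) + Real.sqrt (2 * η / β) • ξ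

/-- The law of the `k`-th SGLD iterate `w_k` on the data set `S = (S 0, …, S (n - 1))`.
The initial point `w_0` has law `N(0, σ₀² I_d)`, and `w_{k+1}` is obtained from `w_k` by an update
with step size `η (k + 1)` at the data point `S i`, where the index `i`, uniform on the `n`
indices, and the noise `ξ ∼ N(0, I_d)` are independent of each other and of `w_k`. -/
def sgldLaw {d n : ℕ} {Z : Type*} (f : EuclideanSpace ℝ (Fin d) → Z → ℝ)
    (R : EuclideanSpace ℝ (Fin d) → ℝ) (β σ₀ : ℝ) (η : ℕ → ℝ) (S : Fin n → Z) :
    ℕ → Measure (EuclideanSpace ℝ (Fin d))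
  | 0 => (stdGaussian (EuclideanSpace ℝ (Fin d))).map (fun x => σ₀ • x)
  | k + 1 =>
      ((sgldLaw f R β σ₀ η S k).prod
        ((uniformOn (Set.univ : Set (Fin n))).prod
          (stdGaussian (EuclideanSpace ℝ (Fin d))))).map
        (fun p => sgldStep f R β (η (k + 1)) (S p.2.1) p.1 p.2.2)

/-- The generalization error, on the data set `S`, of a randomized algorithm whose output has law
`μ`: the expectation over the algorithm of the population loss (for the data distribution `D`)
minus the empirical loss. -/
def genErr {W Z : Type*} [MeasurableSpace W] [MeasurableSpace Z] {n : ℕ} (l : W → Z → ℝ)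
    (D : Measure Z) (S : Fin n → Z) (μ : Measure W) : ℝ :=
  ∫ w, ((∫ z, l w z ∂D) - (1 / (n : ℝ)) * ∑ i, l w (S i)) ∂μ

end

/-! Exchanging a sample point with an independent copy bounds the expected generalization error by
uniform stability (`integral_genErr_le_of_uniformStability`), so it suffices to bound the total
variation between the final laws on two data sets that differ at one index (`tvDistLE_sgldLaw`). The
two laws are compared through a hybrid run that uses the second data set for `k₀` rounds and the
first one afterwards.

In the early rounds the distinguished index is drawn with probability `1 / n`, so each round costs
at most `1 / n`. In the late rounds the squared Bhattacharyya affinity is tracked: its defects add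
up over rounds (`AffinityDefectLE.comp`), and the square root is taken only once, at the end
(`AffinityDefectLE.tvDistLE`). One round is a uniform mixture of `n` Gaussians of which a single
component changes, so the densities differ by `O(1 / n)` and the defect, being quadratic, is `O(1 /
n ^ 2)` (`one_sub_le_mixture_mul_mixture`). This is how a sum of step sizes appears under the root
while the rate stays `1 / n`. -/

open scoped RealInnerProductSpace

/-! ### Translates of the standard Gaussian and their `χ²` integrals. -/

section Gaussian

variable {d : ℕ}

theorem map_inner_stdGaussian (h : EuclideanSpace ℝ (Fin d)) :
    (stdGaussian (EuclideanSpace ℝ (Fin d))).map (fun ξ => ⟪h, ξ⟫)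
      = gaussianReal 0 (‖h‖ ^ 2).toNNReal := by
  have h1 := IsGaussian.map_eq_gaussianReal (μ := stdGaussian (EuclideanSpace ℝ (Fin d)))
    (innerSL ℝ h)
  rw [integral_strongDual_stdGaussian, variance_dual_stdGaussian, innerSL_apply_norm] at h1
  exact h1

theorem integrable_exp_inner_stdGaussian (h : EuclideanSpace ℝ (Fin d)) :
    Integrable (fun ξ => Real.exp ⟪h, ξ⟫) (stdGaussian (EuclideanSpace ℝ (Fin d))) := by
  have h1 := integrable_exp_mul_gaussianReal (μ := 0) (v := (‖h‖ ^ 2).toNNReal) 1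
  rw [← map_inner_stdGaussian h] at h1
  simpa [Function.comp_def] using h1.comp_measurable (f := fun ξ => ⟪h, ξ⟫) (by fun_prop)

theorem integral_exp_inner_stdGaussian (h : EuclideanSpace ℝ (Fin d)) :
    ∫ ξ, Real.exp ⟪h, ξ⟫ ∂stdGaussian (EuclideanSpace ℝ (Fin d)) = Real.exp (‖h‖ ^ 2 / 2) := by
  have h1 := mgf_gaussianReal (map_inner_stdGaussian h) 1
  simpa [mgf] using h1

theorem integral_cexp_mul_gaussianReal (z : ℂ) :
    ∫ x : ℝ, Complex.exp (z * x) ∂gaussianReal 0 1 = Complex.exp (z ^ 2 / 2) := by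
  have h := complexMGF_gaussianReal (p := gaussianReal 0 1) (X := id) (μ := 0) (v := 1) (by simp) z
  simpa [complexMGF] using h

/-- The exponent is a coordinate sum, bilinear in `c`, because a sesquilinear inner product would
give the wrong square for complex `c`. -/
theorem integral_cexp_sum_stdGaussian (c : Fin d → ℂ) :
    ∫ ξ : EuclideanSpace ℝ (Fin d), Complex.exp (∑ i, c i * (ξ i : ℂ))
        ∂stdGaussian (EuclideanSpace ℝ (Fin d)) = Complex.exp (∑ i, c i ^ 2 / 2) := by
  rw [← map_pi_eq_stdGaussian, integral_map (by fun_prop) (by fun_prop)]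
  simp_rw [Complex.exp_sum]
  rw [integral_fintype_prod_eq_prod (f := fun i (x : ℝ) => Complex.exp (c i * x))]
  simp_rw [integral_cexp_mul_gaussianReal]

/-- The density with respect to the standard Gaussian of its translate by `h`. -/
noncomputable def shiftDensity (h ξ : EuclideanSpace ℝ (Fin d)) : ℝ :=
  Real.exp (⟪h, ξ⟫ - ‖h‖ ^ 2 / 2)

@[fun_prop]
theorem measurable_shiftDensity (h : EuclideanSpace ℝ (Fin d)) :
    Measurable (shiftDensity h) := by
  unfold shiftDensity; fun_prop

theorem shiftDensity_pos (h ξ : EuclideanSpace ℝ (Fin d)) : 0 < shiftDensity h ξ :=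
  Real.exp_pos _

theorem integrable_shiftDensity (h : EuclideanSpace ℝ (Fin d)) :
    Integrable (shiftDensity h) (stdGaussian (EuclideanSpace ℝ (Fin d))) := by
  unfold shiftDensity
  simp_rw [Real.exp_sub]
  exact (integrable_exp_inner_stdGaussian h).div_const _

theorem integral_shiftDensity (h : EuclideanSpace ℝ (Fin d)) :
    ∫ ξ, shiftDensity h ξ ∂stdGaussian (EuclideanSpace ℝ (Fin d)) = 1 := by
  unfold shiftDensity
  simp_rw [Real.exp_sub]
  rw [integral_div, integral_exp_inner_stdGaussian, div_self (Real.exp_pos _).ne']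

/-- The finite-dimensional Cameron–Martin formula. Both characteristic functions are Gaussian
integrals with linear exponents, of coefficients `i t` and `h + i t`. -/
theorem map_add_stdGaussian (h : EuclideanSpace ℝ (Fin d)) :
    (stdGaussian (EuclideanSpace ℝ (Fin d))).map (fun ξ => ξ + h)
      = (stdGaussian (EuclideanSpace ℝ (Fin d))).withDensity
          (fun ξ => ENNReal.ofReal (shiftDensity h ξ)) := by
  have : IsFiniteMeasure ((stdGaussian (EuclideanSpace ℝ (Fin d))).withDensity
          (fun ξ => ENNReal.ofReal (shiftDensity h ξ))) :=
    isFiniteMeasure_withDensity_ofReal (integrable_shiftDensity h).2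
  apply Measure.ext_of_charFun
  ext t
  rw [charFun_apply, charFun_apply, integral_map (by fun_prop) (by fun_prop),
    integral_withDensity_eq_integral_toReal_smul (by fun_prop) (by simp)]
  have e1 : ∀ ξ : EuclideanSpace ℝ (Fin d), Complex.exp (⟪ξ + h, t⟫ * Complex.I)
      = Complex.exp (∑ i, (t i * Complex.I) * (ξ i : ℂ)) * Complex.exp (⟪h, t⟫ * Complex.I) := by
    intro ξ
    rw [← Complex.exp_add]
    congr 1
    rw [inner_add_left, PiLp.inner_apply]
    push_cast
    rw [add_mul, Finset.sum_mul]
    congr 1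
    refine Finset.sum_congr rfl fun i _ => ?_
    simp
    ring
  have e2 : ∀ ξ : EuclideanSpace ℝ (Fin d),
      (ENNReal.ofReal (shiftDensity h ξ)).toReal • Complex.exp (⟪ξ, t⟫ * Complex.I)
      = Complex.exp (∑ i, (h i + t i * Complex.I) * (ξ i : ℂ))
        * Complex.exp (-(‖h‖ ^ 2 / 2 : ℝ)) := by
    intro ξ
    rw [ENNReal.toReal_ofReal (shiftDensity_pos _ _).le, shiftDensity, Complex.real_smul,
      Complex.ofReal_exp, ← Complex.exp_add, ← Complex.exp_add]
    congr 1
    rw [PiLp.inner_apply, PiLp.inner_apply]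
    push_cast
    rw [Finset.sum_mul]
    simp_rw [add_mul, Finset.sum_add_distrib]
    have : ∀ a b c e : ℂ, a = c → b = e → ∀ x, a - x + b = c + e + -x := by
      intros; subst_vars; ring
    apply this
    · refine Finset.sum_congr rfl fun i _ => ?_
      simp
      ring
    · refine Finset.sum_congr rfl fun i _ => ?_
      simp
      ring
  simp_rw [e1, e2]
  rw [integral_mul_const, integral_mul_const, integral_cexp_sum_stdGaussian,
    integral_cexp_sum_stdGaussian, ← Complex.exp_add, ← Complex.exp_add]
  congr 1
  rw [EuclideanSpace.real_norm_sq_eq, PiLp.inner_apply]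
  push_cast
  rw [Finset.sum_mul, Finset.sum_div, ← Finset.sum_neg_distrib, ← Finset.sum_add_distrib,
    ← Finset.sum_add_distrib]
  refine Finset.sum_congr rfl fun i _ => ?_
  simp
  ring

theorem integral_add_stdGaussian (h : EuclideanSpace ℝ (Fin d))
    {φ : EuclideanSpace ℝ (Fin d) → ℝ} (hφ : Measurable φ) :
    ∫ ξ, φ (ξ + h) ∂stdGaussian (EuclideanSpace ℝ (Fin d))
      = ∫ ξ, shiftDensity h ξ * φ ξ ∂stdGaussian (EuclideanSpace ℝ (Fin d)) := by
  rw [← integral_map (f := φ) (φ := fun ξ => ξ + h) (by fun_prop) (by fun_prop),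
    map_add_stdGaussian, integral_withDensity_eq_integral_toReal_smul (by fun_prop) (by simp)]
  simp_rw [ENNReal.toReal_ofReal (shiftDensity_pos _ _).le, smul_eq_mul]

/-- Completing the square. The result is a constant times another translate, whose integral is
known, so `χ²` integrals have closed forms. -/
theorem shiftDensity_mul_div (a b h ξ : EuclideanSpace ℝ (Fin d)) :
    shiftDensity a ξ * shiftDensity b ξ / shiftDensity h ξ
      = Real.exp ⟪a - h, b - h⟫ * shiftDensity (a + b - h) ξ := by
  simp only [shiftDensity, ← Real.exp_add, ← Real.exp_sub, Real.exp_eq_exp]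
  simp only [← real_inner_self_eq_norm_sq, inner_add_left, inner_sub_left, inner_add_right,
    inner_sub_right]
  rw [real_inner_comm a b, real_inner_comm a h, real_inner_comm b h]
  ring

theorem sq_shiftDensity_sub_div (a b h ξ : EuclideanSpace ℝ (Fin d)) :
    (shiftDensity a ξ - shiftDensity b ξ) ^ 2 / shiftDensity h ξ
      = Real.exp (‖a - h‖ ^ 2) * shiftDensity (a + a - h) ξ
        + Real.exp (‖b - h‖ ^ 2) * shiftDensity (b + b - h) ξ
        - 2 * (Real.exp ⟪a - h, b - h⟫ * shiftDensity (a + b - h) ξ) := by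
  rw [← real_inner_self_eq_norm_sq, ← real_inner_self_eq_norm_sq, ← shiftDensity_mul_div,
    ← shiftDensity_mul_div, ← shiftDensity_mul_div]
  ring

theorem integrable_sq_shiftDensity_sub_div (a b h : EuclideanSpace ℝ (Fin d)) :
    Integrable (fun ξ => (shiftDensity a ξ - shiftDensity b ξ) ^ 2 / shiftDensity h ξ)
      (stdGaussian (EuclideanSpace ℝ (Fin d))) := by
  simp_rw [sq_shiftDensity_sub_div]
  exact (((integrable_shiftDensity _).const_mul _).add
    ((integrable_shiftDensity _).const_mul _)).sub
      (((integrable_shiftDensity _).const_mul _).const_mul _)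

theorem integral_sq_shiftDensity_sub_div (a b h : EuclideanSpace ℝ (Fin d)) :
    ∫ ξ, (shiftDensity a ξ - shiftDensity b ξ) ^ 2 / shiftDensity h ξ
        ∂stdGaussian (EuclideanSpace ℝ (Fin d))
      = Real.exp (‖a - h‖ ^ 2) + Real.exp (‖b - h‖ ^ 2) - 2 * Real.exp ⟪a - h, b - h⟫ := by
  simp_rw [sq_shiftDensity_sub_div]
  rw [integral_sub, integral_add, integral_const_mul, integral_const_mul, integral_const_mul,
    integral_const_mul, integral_shiftDensity, integral_shiftDensity, integral_shiftDensity]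
  · ring
  · exact (integrable_shiftDensity _).const_mul _
  · exact (integrable_shiftDensity _).const_mul _
  · exact ((integrable_shiftDensity _).const_mul _).add ((integrable_shiftDensity _).const_mul _)
  · exact ((integrable_shiftDensity _).const_mul _).const_mul _

/-- The `χ²`-type integral of two Gaussian translates against a third one, when the three
centres are close to each other. -/
theorem integral_sq_shiftDensity_sub_div_le {a b h : EuclideanSpace ℝ (Fin d)} {r : ℝ}
    (hr : 2 * r ≤ Real.log 2) (hab : ‖a - b‖ ^ 2 ≤ r) (hah : ‖a - h‖ ^ 2 ≤ r)
    (hbh : ‖b - h‖ ^ 2 ≤ r) :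
    ∫ ξ, (shiftDensity a ξ - shiftDensity b ξ) ^ 2 / shiftDensity h ξ
        ∂stdGaussian (EuclideanSpace ℝ (Fin d)) ≤ 2 * r := by
  rw [integral_sq_shiftDensity_sub_div]
  set x := ‖a - h‖ ^ 2 with hx
  set y := ‖b - h‖ ^ 2 with hy
  have hx0 : 0 ≤ x := by positivity
  have hy0 : 0 ≤ y := by positivity
  have hr0 : 0 ≤ r := hx0.trans hah
  have e : ⟪a - h, b - h⟫ = x / 2 + y / 2 - ‖a - b‖ ^ 2 / 2 := by
    have : a - b = (a - h) - (b - h) := by abel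
    rw [this, norm_sub_sq_real]
    ring
  set P := Real.exp (x / 2) with hP
  set Q := Real.exp (y / 2) with hQ
  have eP : Real.exp x = P ^ 2 := by rw [hP, ← Real.exp_nat_mul]; congr 1; push_cast; ring
  have eQ : Real.exp y = Q ^ 2 := by rw [hQ, ← Real.exp_nat_mul]; congr 1; push_cast; ring
  -- This bounds the integral by `(P - Q) ^ 2 + P * Q * r`. Since `P` and `Q` lie in `[1, T]` with
  -- `T = exp (r / 2)`, the first term is of order `r ^ 2` and the second is at most `T ^ 2 * r`.
  have hlow : P * Q * (1 - r / 2) ≤ Real.exp ⟪a - h, b - h⟫ := by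
    rw [e, sub_eq_add_neg (x / 2 + y / 2), Real.exp_add, Real.exp_add]
    have := Real.add_one_le_exp (-(‖a - b‖ ^ 2 / 2))
    have hPQ : 0 < P * Q := by positivity
    exact mul_le_mul_of_nonneg_left (by linarith) hPQ.le
  rw [eP, eQ]
  set T := Real.exp (r / 2) with hT
  have hP1 : 1 ≤ P := Real.one_le_exp (by positivity)
  have hQ1 : 1 ≤ Q := Real.one_le_exp (by positivity)
  have hPT : P ≤ T := Real.exp_le_exp.2 (by linarith)
  have hQT : Q ≤ T := Real.exp_le_exp.2 (by linarith)
  -- The threshold `log 2` enters here: it keeps `T ^ 2` below `3 / 2`, which leaves room for the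
  -- quadratic term under `2 * r`.
  have hT4 : T ^ 4 ≤ 2 := by
    rw [hT, ← Real.exp_nat_mul]
    calc _ ≤ Real.exp (Real.log 2) := Real.exp_le_exp.2 (by push_cast; linarith)
      _ = 2 := Real.exp_log (by norm_num)
  have hT2 : T ^ 2 ≤ 3 / 2 := by nlinarith [sq_nonneg (T ^ 2)]
  have hr1 : r ≤ 0.35 := by linarith [Real.log_two_lt_d9]
  have hT1 : T - 1 ≤ T * (r / 2) := by
    have := Real.add_one_le_exp (-(r / 2))
    rw [Real.exp_neg, ← hT] at this
    have hTp : 0 < T := Real.exp_pos _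
    have h2 : T * T⁻¹ = 1 := mul_inv_cancel₀ hTp.ne'
    nlinarith
  have hd : (P - Q) ^ 2 ≤ (T - 1) ^ 2 := sq_le_sq' (by linarith) (by linarith)
  have hd2 : (T - 1) ^ 2 ≤ T ^ 2 * (r / 2) ^ 2 := by
    rw [← mul_pow]; exact pow_le_pow_left₀ (by linarith) hT1 2
  have hPQ : P * Q ≤ T ^ 2 := by nlinarith
  nlinarith

end Gaussian

/-! ### Affinity of Gaussian mixtures that differ in one component. -/

section Mixture

/-- Both sides are separated by `2√(pq)`: AM–GM on the right; on the left, `(√p + √q)² (1/p + 1/q) ≥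
8`, which is where the `8` comes from. -/
theorem add_sub_sq_mul_inv_le {u p q : ℝ} (hu : 0 < u) (hp : 0 < p) (hq : 0 < q) :
    p + q - ((p - q) ^ 2 / p + (p - q) ^ 2 / q) / 8 ≤ p * u + q * u⁻¹ := by
  obtain ⟨s, hs, rfl⟩ : ∃ s : ℝ, 0 < s ∧ s ^ 2 = p := ⟨√p, by positivity, Real.sq_sqrt hp.le⟩
  obtain ⟨t, ht, rfl⟩ : ∃ t : ℝ, 0 < t ∧ t ^ 2 = q := ⟨√q, by positivity, Real.sq_sqrt hq.le⟩
  have h1 : 2 * (s * t) ≤ s ^ 2 * u + t ^ 2 * u⁻¹ := by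
    have h : s ^ 2 * u + t ^ 2 * u⁻¹ - 2 * (s * t) = (s * u - t) ^ 2 * u⁻¹ := by
      field_simp; ring
    have : 0 ≤ (s * u - t) ^ 2 * u⁻¹ := by positivity
    linarith
  have h2 : ((s ^ 2 - t ^ 2) ^ 2 / s ^ 2 + (s ^ 2 - t ^ 2) ^ 2 / t ^ 2) / 8
      - (s ^ 2 + t ^ 2 - 2 * (s * t))
      = (s - t) ^ 2 * ((s - t) ^ 2 * (s ^ 2 + t ^ 2) + 4 * (s * t) * (s - t) ^ 2)
        / (8 * (s ^ 2 * t ^ 2)) := by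
    field_simp; ring
  have h3 : 0 ≤ (s - t) ^ 2 * ((s - t) ^ 2 * (s ^ 2 + t ^ 2) + 4 * (s * t) * (s - t) ^ 2)
        / (8 * (s ^ 2 * t ^ 2)) := by positivity
  linarith

/-- Scaling turns an additive bound into a product bound. The choice `s = x / (2 * A)` suffices and
avoids the root in the true minimiser. -/
theorem sq_le_mul_of_forall_le {A B x : ℝ} (hA : 0 < A) (hB : 0 < B)
    (h : ∀ s > 0, x ≤ s * A + s⁻¹ * B) (hx : 0 ≤ x) : (x / 2) ^ 2 ≤ A * B := by
  have h1 := h (x / (2 * A))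
  rcases hx.eq_or_lt with rfl | hx
  · simpa using (mul_pos hA hB).le
  · have h2 := h1 (by positivity)
    have e : x / (2 * A) * A + (x / (2 * A))⁻¹ * B = x / 2 + 2 * (A * B) / x := by
      field_simp
    rw [e] at h2
    have h3 : x / 2 ≤ 2 * (A * B) / x := by linarith
    rw [le_div_iff₀ hx] at h3
    nlinarith

/-- Cauchy–Schwarz, used to replace a mixture in a denominator by its single components. -/
theorem div_mean_le {n : ℕ} (hn : 0 < n) (D : ℝ) {g : Fin n → ℝ} (hg : ∀ j, 0 < g j) :
    ((n : ℝ)⁻¹ * D) ^ 2 / ((n : ℝ)⁻¹ * ∑ j, g j) ≤ (n : ℝ)⁻¹ ^ 3 * ∑ j, D ^ 2 / g j := by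
  have hn' : (0 : ℝ) < n := by exact_mod_cast hn
  have h := Finset.sq_sum_div_le_sum_sq_div Finset.univ (fun _ : Fin n => D) (fun j _ => hg j)
  rw [Finset.sum_const, Finset.card_univ, Fintype.card_fin, nsmul_eq_mul] at h
  have hs : 0 < ∑ j, g j :=
    Finset.sum_pos (fun j _ => hg j) ⟨⟨0, hn⟩, Finset.mem_univ _⟩
  calc _ = (n : ℝ)⁻¹ ^ 3 * ((n * D) ^ 2 / ∑ j, g j) := by field_simp
    _ ≤ _ := mul_le_mul_of_nonneg_left h (by positivity)

variable {d n : ℕ}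

/-- The density of a uniform mixture of translated standard Gaussians. -/
noncomputable def mixtureDensity (h : Fin n → EuclideanSpace ℝ (Fin d))
    (ξ : EuclideanSpace ℝ (Fin d)) : ℝ :=
  (n : ℝ)⁻¹ * ∑ j, shiftDensity (h j) ξ

theorem mixtureDensity_pos (hn : 0 < n) (h : Fin n → EuclideanSpace ℝ (Fin d))
    (ξ : EuclideanSpace ℝ (Fin d)) : 0 < mixtureDensity h ξ :=
  mul_pos (by positivity)
    (Finset.sum_pos (fun j _ => shiftDensity_pos _ _) ⟨⟨0, hn⟩, Finset.mem_univ _⟩)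

theorem integrable_mixtureDensity (h : Fin n → EuclideanSpace ℝ (Fin d)) :
    Integrable (mixtureDensity h) (stdGaussian (EuclideanSpace ℝ (Fin d))) :=
  (integrable_finsetSum _ fun j _ => integrable_shiftDensity (h j)).const_mul _

theorem integral_mixtureDensity (hn : 0 < n) (h : Fin n → EuclideanSpace ℝ (Fin d)) :
    ∫ ξ, mixtureDensity h ξ ∂stdGaussian (EuclideanSpace ℝ (Fin d)) = 1 := by
  have hn' : (n : ℝ) ≠ 0 := by positivity
  unfold mixtureDensity
  rw [integral_const_mul, integral_finsetSum _ fun j _ => integrable_shiftDensity (h j)]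
  simp [integral_shiftDensity, hn']

theorem integral_mixtureDensity_mul (h : Fin n → EuclideanSpace ℝ (Fin d))
    {φ : EuclideanSpace ℝ (Fin d) → ℝ} (hφ : Measurable φ) {M : ℝ} (hM : ∀ x, |φ x| ≤ M) :
    ∫ ξ, mixtureDensity h ξ * φ ξ ∂stdGaussian (EuclideanSpace ℝ (Fin d))
      = (n : ℝ)⁻¹ * ∑ j, ∫ ξ, φ (ξ + h j) ∂stdGaussian (EuclideanSpace ℝ (Fin d)) := by
  simp_rw [integral_add_stdGaussian _ hφ, mixtureDensity, mul_assoc, Finset.sum_mul]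
  rw [integral_const_mul, integral_finsetSum]
  intro j _
  exact (integrable_shiftDensity (h j)).mul_bdd (c := M) (by fun_prop) (by simpa using ae_of_all _ hM)

/-- Two uniform mixtures of `n` translated standard Gaussians which differ in one component and
whose centres are close have Bhattacharyya affinity at least `√(1 - r / (2 n²))`. -/
theorem one_sub_le_mixture_mul_mixture (hn : 0 < n) {h h' : Fin n → EuclideanSpace ℝ (Fin d)}
    (i : Fin n) (hi : ∀ j ≠ i, h j = h' j) {r : ℝ} (hr : 2 * r ≤ Real.log 2)
    (h11 : ∀ j k, ‖h j - h k‖ ^ 2 ≤ r) (h12 : ∀ j k, ‖h j - h' k‖ ^ 2 ≤ r)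
    (h22 : ∀ j k, ‖h' j - h' k‖ ^ 2 ≤ r)
    {φ : EuclideanSpace ℝ (Fin d) → ℝ} (hφ : Measurable φ) {m M : ℝ} (hm : 0 < m)
    (hmφ : ∀ x, m ≤ φ x) (hφM : ∀ x, φ x ≤ M) :
    1 - r / (2 * n ^ 2) ≤
      ((n : ℝ)⁻¹ * ∑ j, ∫ ξ, φ (ξ + h j) ∂stdGaussian (EuclideanSpace ℝ (Fin d)))
      * ((n : ℝ)⁻¹ * ∑ j, ∫ ξ, (φ (ξ + h' j))⁻¹ ∂stdGaussian (EuclideanSpace ℝ (Fin d))) := by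
  have hn' : (0 : ℝ) < n := by exact_mod_cast hn
  have hn1 : (1 : ℝ) ≤ n := by exact_mod_cast hn
  have hφ0 : ∀ x, 0 < φ x := fun x => hm.trans_le (hmφ x)
  have hb : ∀ x, |φ x| ≤ M := fun x => by rw [abs_of_pos (hφ0 x)]; exact hφM x
  have hb' : ∀ x, |(φ x)⁻¹| ≤ m⁻¹ := fun x => by
    rw [abs_of_pos (inv_pos.2 (hφ0 x))]; exact inv_anti₀ hm (hmφ x)
  rw [← integral_mixtureDensity_mul h hφ hb,
    ← integral_mixtureDensity_mul h' (φ := fun x => (φ x)⁻¹) (by fun_prop) hb']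
  set γ := stdGaussian (EuclideanSpace ℝ (Fin d))
  have iA : Integrable (fun ξ => mixtureDensity h ξ * φ ξ) γ :=
    (integrable_mixtureDensity h).mul_bdd (c := M) (by fun_prop) (by simpa using ae_of_all _ hb)
  have iB : Integrable (fun ξ => mixtureDensity h' ξ * (φ ξ)⁻¹) γ :=
    (integrable_mixtureDensity h').mul_bdd (c := m⁻¹) (by fun_prop)
      (by simpa using ae_of_all _ hb')
  have hM0 : 0 < M := (hφ0 0).trans_le (hφM 0)
  have hA : 0 < ∫ ξ, mixtureDensity h ξ * φ ξ ∂γ := by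
    refine hm.trans_le ?_
    calc m = ∫ ξ, mixtureDensity h ξ * m ∂γ := by
          rw [integral_mul_const, integral_mixtureDensity hn, one_mul]
      _ ≤ _ := integral_mono ((integrable_mixtureDensity h).mul_const m) iA fun ξ =>
          mul_le_mul_of_nonneg_left (hmφ ξ) (mixtureDensity_pos hn h ξ).le
  have hB : 0 < ∫ ξ, mixtureDensity h' ξ * (φ ξ)⁻¹ ∂γ := by
    refine (inv_pos.2 hM0).trans_le ?_
    calc M⁻¹ = ∫ ξ, mixtureDensity h' ξ * M⁻¹ ∂γ := by
          rw [integral_mul_const, integral_mixtureDensity hn, one_mul]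
      _ ≤ _ := integral_mono ((integrable_mixtureDensity h').mul_const _) iB fun ξ =>
          mul_le_mul_of_nonneg_left (inv_anti₀ (hφ0 ξ) (hφM ξ)) (mixtureDensity_pos hn h' ξ).le
  have hr0 : 0 ≤ r := (sq_nonneg _).trans (h11 i i)
  have hr1 : r ≤ 1 := by linarith [Real.log_two_lt_d9]
  let D : EuclideanSpace ℝ (Fin d) → ℝ := fun ξ => shiftDensity (h i) ξ - shiftDensity (h' i) ξ
  have hD : ∀ ξ, mixtureDensity h ξ - mixtureDensity h' ξ = (n : ℝ)⁻¹ * D ξ := by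
    intro ξ
    rw [mixtureDensity, mixtureDensity, ← mul_sub, ← Finset.sum_sub_distrib,
      Finset.sum_eq_single i]
    · intro j _ hj
      rw [hi j hj, sub_self]
    · simp
  have hχ : ∀ g : Fin n → EuclideanSpace ℝ (Fin d),
      Integrable (fun ξ => (n : ℝ)⁻¹ ^ 3 * ∑ j, D ξ ^ 2 / shiftDensity (g j) ξ) γ := fun g =>
    (integrable_finsetSum _ fun j _ => integrable_sq_shiftDensity_sub_div _ _ _).const_mul _
  -- The prefactor `n⁻³` times `n` terms of size at most `2 * r` gives the decay `n⁻²`.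
  have hχle : ∀ g : Fin n → EuclideanSpace ℝ (Fin d), (∀ j, ‖h i - g j‖ ^ 2 ≤ r) →
      (∀ j, ‖h' i - g j‖ ^ 2 ≤ r) →
      ∫ ξ, (n : ℝ)⁻¹ ^ 3 * ∑ j, D ξ ^ 2 / shiftDensity (g j) ξ ∂γ ≤ 2 * r / n ^ 2 := by
    intro g hg hg'
    rw [integral_const_mul,
      integral_finsetSum _ fun j _ => integrable_sq_shiftDensity_sub_div _ _ _]
    calc _ ≤ (n : ℝ)⁻¹ ^ 3 * ∑ j : Fin n, 2 * r := by
          gcongr with j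
          exact integral_sq_shiftDensity_sub_div_le hr (h12 i i) (hg j) (hg' j)
      _ = _ := by
          rw [Finset.sum_const, Finset.card_univ, Fintype.card_fin, nsmul_eq_mul]
          field_simp
  have key : ∀ s > 0, 2 - r / (2 * n ^ 2) ≤
      s * ∫ ξ, mixtureDensity h ξ * φ ξ ∂γ + s⁻¹ * ∫ ξ, mixtureDensity h' ξ * (φ ξ)⁻¹ ∂γ := by
    intro s hs
    have i1 : Integrable (fun ξ => mixtureDensity h ξ + mixtureDensity h' ξ) γ :=
      (integrable_mixtureDensity h).add (integrable_mixtureDensity h')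
    have i2 : Integrable (fun ξ => ((n : ℝ)⁻¹ ^ 3 * ∑ j, D ξ ^ 2 / shiftDensity (h j) ξ
          + (n : ℝ)⁻¹ ^ 3 * ∑ j, D ξ ^ 2 / shiftDensity (h' j) ξ) / 8) γ :=
      ((hχ h).add (hχ h')).div_const 8
    calc 2 - r / (2 * n ^ 2)
        ≤ ∫ ξ, (mixtureDensity h ξ + mixtureDensity h' ξ
          - ((n : ℝ)⁻¹ ^ 3 * ∑ j, D ξ ^ 2 / shiftDensity (h j) ξ
            + (n : ℝ)⁻¹ ^ 3 * ∑ j, D ξ ^ 2 / shiftDensity (h' j) ξ) / 8) ∂γ := by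
          rw [integral_sub i1 i2, integral_div, integral_add (hχ h) (hχ h'),
            integral_add (integrable_mixtureDensity h) (integrable_mixtureDensity h'),
            integral_mixtureDensity hn, integral_mixtureDensity hn]
          have e1 := hχle h (fun j => h11 i j)
            (fun j => by rw [norm_sub_rev]; exact h12 j i)
          have e2 := hχle h' (fun j => h12 i j) (fun j => h22 i j)
          have e3 : r / (2 * n ^ 2) = (2 * r / n ^ 2 + 2 * r / n ^ 2) / 8 := by
            field_simp; ring
          linarith
      _ ≤ ∫ ξ, (s * (mixtureDensity h ξ * φ ξ) + s⁻¹ * (mixtureDensity h' ξ * (φ ξ)⁻¹)) ∂γ := by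
          refine integral_mono (i1.sub i2) ((iA.const_mul s).add (iB.const_mul s⁻¹)) fun ξ => ?_
          have h1 := add_sub_sq_mul_inv_le (mul_pos hs (hφ0 ξ)) (mixtureDensity_pos hn h ξ)
            (mixtureDensity_pos hn h' ξ)
          have h2 := div_mean_le hn (D ξ) fun j => shiftDensity_pos (h j) ξ
          have h3 := div_mean_le hn (D ξ) fun j => shiftDensity_pos (h' j) ξ
          rw [← mixtureDensity, ← hD] at h2 h3
          rw [mul_inv] at h1
          simp only
          linarith
      _ = _ := by
          rw [integral_add (iA.const_mul s) (iB.const_mul s⁻¹), integral_const_mul,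
            integral_const_mul]
  have hsmall : r / (2 * n ^ 2) ≤ 2 := by
    rw [div_le_iff₀ (by positivity)]
    nlinarith
  -- With `t = r / (2 * n ^ 2)`, this is a lower bound by `(1 - t / 2) ^ 2`, which is at least `1 -
  -- t`.
  have := sq_le_mul_of_forall_le hA hB key (by linarith)
  nlinarith [sq_nonneg (r / (2 * (n : ℝ) ^ 2))]

end Mixture

/-! ### Dual forms of total variation and affinity, and their behaviour under kernels. -/

section Distances

variable {X Y : Type*} [MeasurableSpace X] [MeasurableSpace Y]

/-- The total variation distance of `μ` and `ν` is at most `ε`, in its dual form. -/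
def TVDistLE (μ ν : Measure X) (ε : ℝ) : Prop :=
  ∀ l : X → ℝ, Measurable l → (∀ x, |l x| ≤ 1) → |∫ x, l x ∂μ - ∫ x, l x ∂ν| ≤ 2 * ε

/-- The squared Bhattacharyya affinity of `μ` and `ν` is at least `1 - δ`, in its dual form. -/
def AffinityDefectLE (μ ν : Measure X) (δ : ℝ) : Prop :=
  ∀ φ : X → ℝ, Measurable φ → ∀ m M : ℝ, 0 < m → (∀ x, m ≤ φ x) → (∀ x, φ x ≤ M) →
    1 - δ ≤ (∫ x, φ x ∂μ) * ∫ x, (φ x)⁻¹ ∂ν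

theorem integrable_of_abs_le {μ : Measure X} [IsFiniteMeasure μ] {l : X → ℝ} (hl : Measurable l)
    {M : ℝ} (hM : ∀ x, |l x| ≤ M) : Integrable l μ :=
  Integrable.of_bound (by fun_prop) M (by simpa using ae_of_all _ hM)

theorem abs_integral_le_of_abs_le {μ : Measure X} [IsProbabilityMeasure μ] {l : X → ℝ}
    {M : ℝ} (hM : ∀ x, |l x| ≤ M) : |∫ x, l x ∂μ| ≤ M := by
  simpa using norm_integral_le_of_norm_le_const (μ := μ) (f := l) (C := M) (ae_of_all _ hM)

theorem le_integral_of_forall_le {μ : Measure X} [IsProbabilityMeasure μ] {l : X → ℝ}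
    (hl : Integrable l μ) {m : ℝ} (hm : ∀ x, m ≤ l x) : m ≤ ∫ x, l x ∂μ := by
  simpa using integral_mono (integrable_const m) hl hm

theorem integral_le_of_forall_le {μ : Measure X} [IsProbabilityMeasure μ] {l : X → ℝ}
    (hl : Integrable l μ) {M : ℝ} (hM : ∀ x, l x ≤ M) : ∫ x, l x ∂μ ≤ M := by
  simpa using integral_mono hl (integrable_const M) hM

theorem integral_bind_kernel {μ : Measure X} [SFinite μ] {κ : Kernel X Y} [IsSFiniteKernel κ]
    {l : Y → ℝ} (hl : Integrable l (μ.bind κ)) :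
    ∫ y, l y ∂(μ.bind κ) = ∫ x, ∫ y, l y ∂κ x ∂μ := by
  have e : (κ ∘ₖ Kernel.const Unit μ) () = μ.bind κ := by
    rw [Kernel.comp_apply, Kernel.const_apply]
  rw [← e] at hl ⊢
  rw [Kernel.integral_comp hl, Kernel.const_apply]

theorem TVDistLE.refl (μ : Measure X) : TVDistLE μ μ 0 := by
  intro l _ _
  simp

theorem TVDistLE.trans {μ ν ρ : Measure X} {ε ε' : ℝ} (h : TVDistLE μ ν ε)
    (h' : TVDistLE ν ρ ε') : TVDistLE μ ρ (ε + ε') := by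
  intro l hl hb
  have := abs_sub_le (∫ x, l x ∂μ) (∫ x, l x ∂ν) (∫ x, l x ∂ρ)
  linarith [h l hl hb, h' l hl hb]

theorem TVDistLE.abs_integral_sub_le {μ ν : Measure X} {ε : ℝ} (h : TVDistLE μ ν ε)
    {l : X → ℝ} (hl : Measurable l) {C : ℝ} (hC : ∀ x, |l x| ≤ C) (hC0 : 0 ≤ C) :
    |∫ x, l x ∂μ - ∫ x, l x ∂ν| ≤ 2 * C * ε := by
  rcases hC0.eq_or_lt with rfl | hC0
  · have : ∀ x, l x = 0 := fun x => abs_nonpos_iff.1 (hC x)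
    simp [this]
  · have := h (fun x => l x / C) (by fun_prop) fun x => by
      rw [abs_div, abs_of_pos hC0, div_le_one hC0]; exact hC x
    rw [integral_div, integral_div, ← sub_div, abs_div, abs_of_pos hC0, div_le_iff₀ hC0] at this
    linarith

/-- Insert `ν.bind κ` in between; the `κ`-average of a test function is again a test function. -/
theorem TVDistLE.comp {μ ν : Measure X} [IsProbabilityMeasure μ] [IsProbabilityMeasure ν]
    {κ κ' : Kernel X Y} [IsMarkovKernel κ] [IsMarkovKernel κ'] {ε ε' : ℝ}
    (h : TVDistLE μ ν ε) (h' : ∀ x, TVDistLE (κ x) (κ' x) ε') :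
    TVDistLE (μ.bind κ) (ν.bind κ') (ε + ε') := by
  intro l hl hb
  have m1 : Measurable fun x => ∫ y, l y ∂κ x := hl.stronglyMeasurable.integral_kernel.measurable
  have m2 : Measurable fun x => ∫ y, l y ∂κ' x := hl.stronglyMeasurable.integral_kernel.measurable
  have b1 : ∀ x, |∫ y, l y ∂κ x| ≤ 1 := fun x => abs_integral_le_of_abs_le hb
  have b2 : ∀ x, |∫ y, l y ∂κ' x| ≤ 1 := fun x => abs_integral_le_of_abs_le hb
  rw [integral_bind_kernel (integrable_of_abs_le hl hb),
    integral_bind_kernel (integrable_of_abs_le hl hb)]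
  have h1 := h _ m1 b1
  have h2 : |∫ x, ∫ y, l y ∂κ x ∂ν - ∫ x, ∫ y, l y ∂κ' x ∂ν| ≤ 2 * ε' := by
    rw [← integral_sub (integrable_of_abs_le m1 b1) (integrable_of_abs_le m2 b2)]
    exact abs_integral_le_of_abs_le fun x => h' x l hl hb
  have := abs_sub_le (∫ x, ∫ y, l y ∂κ x ∂μ) (∫ x, ∫ y, l y ∂κ x ∂ν) (∫ x, ∫ y, l y ∂κ' x ∂ν)
  linarith

theorem abs_inv_le_inv {X : Type*} {φ : X → ℝ} {m : ℝ} (hm : 0 < m) (hmφ : ∀ x, m ≤ φ x) (x : X) :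
    |(φ x)⁻¹| ≤ m⁻¹ := by
  rw [abs_of_pos (inv_pos.2 (hm.trans_le (hmφ x)))]
  exact inv_anti₀ hm (hmφ x)

theorem abs_le_of_pos_le {X : Type*} {φ : X → ℝ} {m M : ℝ} (hm : 0 < m) (hmφ : ∀ x, m ≤ φ x)
    (hφM : ∀ x, φ x ≤ M) (x : X) : |φ x| ≤ M := by
  rw [abs_of_pos (hm.trans_le (hmφ x))]
  exact hφM x

theorem AffinityDefectLE.refl (μ : Measure X) [IsProbabilityMeasure μ] :
    AffinityDefectLE μ μ 0 := by
  intro φ hφ m M hm hmφ hφM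
  have hφ0 : ∀ x, 0 < φ x := fun x => hm.trans_le (hmφ x)
  have i1 : Integrable φ μ := integrable_of_abs_le hφ (abs_le_of_pos_le hm hmφ hφM)
  have i2 : Integrable (fun x => (φ x)⁻¹) μ :=
    integrable_of_abs_le (by fun_prop) (abs_inv_le_inv hm hmφ)
  obtain ⟨x₀⟩ := μ.nonempty_of_neZero
  have hM : 0 < M := (hφ0 x₀).trans_le (hφM x₀)
  have h1 : 0 < ∫ x, φ x ∂μ := hm.trans_le (le_integral_of_forall_le i1 hmφ)
  have h2 : 0 < ∫ x, (φ x)⁻¹ ∂μ := (inv_pos.2 hM).trans_le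
    (le_integral_of_forall_le i2 fun x => inv_anti₀ (hφ0 x) (hφM x))
  have := sq_le_mul_of_forall_le h1 h2 (x := 2) (fun s hs => ?_) (by norm_num)
  · linarith
  · rw [← integral_const_mul, ← integral_const_mul,
      ← integral_add (i1.const_mul _) (i2.const_mul _)]
    refine le_integral_of_forall_le ((i1.const_mul _).add (i2.const_mul _)) fun x => ?_
    have hp := mul_pos hs (hφ0 x)
    have e : s * φ x + s⁻¹ * (φ x)⁻¹ - 2 = (s * φ x - 1) ^ 2 / (s * φ x) := by
      have := (hφ0 x).ne'
      field_simp; ring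
    have : 0 ≤ (s * φ x - 1) ^ 2 / (s * φ x) := by positivity
    simp only [Pi.add_apply]
    linarith

/-- The dual form pays off here, as no densities are needed. The function `x ↦ ∫ φ ∂κ x` is an
admissible test for `μ` and `ν`, and the kernel hypothesis bounds its reciprocal by the `κ'`-average
of `φ⁻¹`, up to the factor `1 - δ'`. -/
theorem AffinityDefectLE.comp {μ ν : Measure X} [IsProbabilityMeasure μ] [IsProbabilityMeasure ν]
    {κ κ' : Kernel X Y} [IsMarkovKernel κ] [IsMarkovKernel κ'] {δ δ' : ℝ}
    (h : AffinityDefectLE μ ν δ) (h' : ∀ x, AffinityDefectLE (κ x) (κ' x) δ')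
    (hδ : 0 ≤ δ) (hδ' : 0 ≤ δ') (hδ1 : δ' ≤ 1) :
    AffinityDefectLE (μ.bind κ) (ν.bind κ') (δ + δ') := by
  intro φ hφ m M hm hmφ hφM
  have b1 := abs_le_of_pos_le hm hmφ hφM
  have b2 := abs_inv_le_inv hm hmφ
  have hφi : Measurable fun y => (φ y)⁻¹ := by fun_prop
  rw [integral_bind_kernel (integrable_of_abs_le hφ b1),
    integral_bind_kernel (integrable_of_abs_le hφi b2)]
  have m1 : Measurable fun x => ∫ y, φ y ∂κ x := hφ.stronglyMeasurable.integral_kernel.measurable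
  have m2 : Measurable fun x => ∫ y, (φ y)⁻¹ ∂κ' x :=
    hφi.stronglyMeasurable.integral_kernel.measurable
  have l1 : ∀ x, m ≤ ∫ y, φ y ∂κ x := fun x =>
    le_integral_of_forall_le (integrable_of_abs_le hφ b1) hmφ
  have u1 : ∀ x, ∫ y, φ y ∂κ x ≤ M := fun x =>
    integral_le_of_forall_le (integrable_of_abs_le hφ b1) hφM
  have h1 := h _ m1 m M hm l1 u1
  have p1 : 0 < ∫ x, ∫ y, φ y ∂κ x ∂μ := hm.trans_le
    (le_integral_of_forall_le (integrable_of_abs_le m1 (abs_le_of_pos_le hm l1 u1)) l1)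
  have h2 : (1 - δ') * ∫ x, (∫ y, φ y ∂κ x)⁻¹ ∂ν ≤ ∫ x, ∫ y, (φ y)⁻¹ ∂κ' x ∂ν := by
    rw [← integral_const_mul]
    refine integral_mono ((integrable_of_abs_le (by fun_prop) (abs_inv_le_inv hm l1)).const_mul _)
      (integrable_of_abs_le m2 fun x => abs_integral_le_of_abs_le b2) fun x => ?_
    have := h' x φ hφ m M hm hmφ hφM
    have hp := hm.trans_le (l1 x)
    simp only
    rw [← div_eq_mul_inv, div_le_iff₀ hp]
    linarith
  calc 1 - (δ + δ') ≤ (1 - δ') * (1 - δ) := by nlinarith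
    _ ≤ (1 - δ') * ((∫ x, ∫ y, φ y ∂κ x ∂μ) * ∫ x, (∫ y, φ y ∂κ x)⁻¹ ∂ν) :=
        mul_le_mul_of_nonneg_left h1 (by linarith)
    _ = (∫ x, ∫ y, φ y ∂κ x ∂μ) * ((1 - δ') * ∫ x, (∫ y, φ y ∂κ x)⁻¹ ∂ν) := by ring
    _ ≤ _ := mul_le_mul_of_nonneg_left h2 p1.le

/-- The case of two Bernoulli laws, tested with the values `t` and `1`. With `u = x - y`, the value
`t = (1 - u) / (1 + u)` is optimal when `x + y = 1` and good enough otherwise; it degenerates at `u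
= ±1`, hence the two separate cases. -/
theorem sq_sub_le_of_two_point_affinity {x y δ : ℝ} (hx0 : 0 ≤ x) (hx1 : x ≤ 1) (hy0 : 0 ≤ y)
    (hy1 : y ≤ 1) (h : ∀ t > 0, 1 - δ ≤ (1 + (t - 1) * x) * (1 + (t⁻¹ - 1) * y)) :
    (x - y) ^ 2 ≤ δ := by
  rcases le_or_gt 1 (x - y) with hu | hu
  · obtain rfl : x = 1 := by linarith
    obtain rfl : y = 0 := by linarith
    by_contra! hδ
    have := h ((1 - δ) / 2) (by linarith)
    linarith
  rcases le_or_gt (x - y) (-1) with hu' | hu'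
  · obtain rfl : x = 0 := by linarith
    obtain rfl : y = 1 := by linarith
    by_contra! hδ
    have := h ((1 - δ) / 2)⁻¹ (inv_pos.2 (by linarith))
    rw [inv_inv] at this
    linarith
  set u := x - y with hu_def
  have h1 : 0 < 1 + u := by linarith
  have h2 : 0 < 1 - u := by linarith
  have := h ((1 - u) / (1 + u)) (div_pos h2 h1)
  have e : 1 - (1 + ((1 - u) / (1 + u) - 1) * x) * (1 + (((1 - u) / (1 + u))⁻¹ - 1) * y) - u ^ 2
      = u ^ 2 * (1 - x - y) ^ 2 / ((1 + u) * (1 - u)) := by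
    have hx : x = y + u := by rw [hu_def]; ring
    rw [hx]
    field_simp
    ring
  have : 0 ≤ u ^ 2 * (1 - x - y) ^ 2 / ((1 + u) * (1 - u)) := by positivity
  linarith

/-- Rescale `l` to `v` with values in `[0, 1]` and test with `1 + (t - 1) * v`. Convexity of the
inverse bounds its reciprocal by `1 + (t⁻¹ - 1) * v`, which reduces the claim to two points. -/
theorem AffinityDefectLE.tvDistLE {μ ν : Measure X} [IsProbabilityMeasure μ]
    [IsProbabilityMeasure ν] {δ : ℝ} (h : AffinityDefectLE μ ν δ) : TVDistLE μ ν √δ := by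
  intro l hl hb
  set v : X → ℝ := fun x => (1 + l x) / 2 with hv
  have hvm : Measurable v := by fun_prop
  have hv0 : ∀ x, 0 ≤ v x := fun x => by have := (abs_le.1 (hb x)).1; simp only [hv]; linarith
  have hv1 : ∀ x, v x ≤ 1 := fun x => by have := (abs_le.1 (hb x)).2; simp only [hv]; linarith
  have hvb : ∀ x, |v x| ≤ 1 := fun x => by rw [abs_of_nonneg (hv0 x)]; exact hv1 x
  have iv : ∀ (ρ : Measure X) [IsProbabilityMeasure ρ], Integrable v ρ := fun ρ _ =>
    integrable_of_abs_le hvm hvb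
  have il : ∀ (ρ : Measure X) [IsProbabilityMeasure ρ], ∫ x, l x ∂ρ = 2 * ∫ x, v x ∂ρ - 1 := by
    intro ρ _
    have : ∀ x, v x = 2⁻¹ + 2⁻¹ * l x := fun x => by simp only [hv]; ring
    simp_rw [this]
    rw [integral_add (integrable_const _) ((integrable_of_abs_le hl hb).const_mul _),
      integral_const_mul]
    simp only [integral_const, probReal_univ, smul_eq_mul]
    ring
  have key := sq_sub_le_of_two_point_affinity (δ := δ)
    (le_integral_of_forall_le (iv μ) hv0) (integral_le_of_forall_le (iv μ) hv1)
    (le_integral_of_forall_le (iv ν) hv0) (integral_le_of_forall_le (iv ν) hv1) fun t ht => ?_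
  · rw [il μ, il ν]
    have h3 := Real.abs_le_sqrt key
    calc _ = 2 * |∫ x, v x ∂μ - ∫ x, v x ∂ν| := by
          rw [← abs_two, ← abs_mul, abs_two]; congr 1; ring
      _ ≤ _ := by linarith
  · have hφm : ∀ x, min t 1 ≤ 1 + (t - 1) * v x := fun x => by
      rcases le_total t 1 with h1 | h1
      · rw [min_eq_left h1]; nlinarith [hv0 x, hv1 x]
      · rw [min_eq_right h1]; nlinarith [hv0 x, hv1 x]
    have hφM : ∀ x, 1 + (t - 1) * v x ≤ max t 1 := fun x => by
      rcases le_total t 1 with h1 | h1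
      · rw [max_eq_right h1]; nlinarith [hv0 x, hv1 x]
      · rw [max_eq_left h1]; nlinarith [hv0 x, hv1 x]
    have hm : 0 < min t 1 := lt_min ht one_pos
    have h1 := h (fun x => 1 + (t - 1) * v x) (by fun_prop) _ _ hm hφm hφM
    have ic : ∀ (ρ : Measure X) [IsProbabilityMeasure ρ] (s : ℝ),
        ∫ x, (1 + (s - 1) * v x) ∂ρ = 1 + (s - 1) * ∫ x, v x ∂ρ := by
      intro ρ _ s
      rw [integral_add (integrable_const _) ((iv ρ).const_mul _), integral_const_mul]
      simp
    have p1 : 0 ≤ ∫ x, (1 + (t - 1) * v x) ∂μ :=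
      integral_nonneg fun x => hm.le.trans (hφm x)
    rw [← ic μ, ← ic ν]
    refine h1.trans (mul_le_mul_of_nonneg_left ?_ p1)
    refine integral_mono (integrable_of_abs_le (by fun_prop) (abs_inv_le_inv hm hφm))
      ((integrable_const _).add ((iv ν).const_mul _)) fun x => ?_
    have hp := hm.trans_le (hφm x)
    simp only
    rw [inv_le_iff_one_le_mul₀ hp]
    have e : (1 + (t⁻¹ - 1) * v x) * (1 + (t - 1) * v x)
        = 1 + (t - 1) ^ 2 / t * (v x * (1 - v x)) := by
      field_simp; ring
    rw [e]
    have : 0 ≤ (t - 1) ^ 2 / t * (v x * (1 - v x)) :=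
      mul_nonneg (by positivity) (mul_nonneg (hv0 x) (by linarith [hv1 x]))
    linarith

end Distances

/-! ### Joint measurability of gradients and of the update. -/

section Measurability

variable {d : ℕ} {Z : Type*} [MeasurableSpace Z]

/-- Each coordinate is a pointwise limit of difference quotients with step `1 / m`, so
differentiability in `w` is enough. -/
theorem measurable_gradient_with_param {f : EuclideanSpace ℝ (Fin d) → Z → ℝ}
    (hf : Measurable (Function.uncurry f)) (hfd : ∀ z, Differentiable ℝ (fun w => f w z)) :
    Measurable fun p : EuclideanSpace ℝ (Fin d) × Z => gradient (fun v => f v p.2) p.1 := by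
  have hcoord : ∀ j : Fin d, Measurable fun p : EuclideanSpace ℝ (Fin d) × Z =>
      (gradient (fun v => f v p.2) p.1) j := by
    intro j
    set e : EuclideanSpace ℝ (Fin d) := EuclideanSpace.single j 1
    refine measurable_of_tendsto_metrizable (f := fun (m : ℕ)
      (p : EuclideanSpace ℝ (Fin d) × Z) => (m : ℝ) • (f (p.1 + (m : ℝ)⁻¹ • e) p.2 - f p.1 p.2))
      (fun m => ?_) (tendsto_pi_nhds.2 fun p => ?_)
    · have h1 : Measurable fun p : EuclideanSpace ℝ (Fin d) × Z => f (p.1 + (m : ℝ)⁻¹ • e) p.2 :=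
        hf.comp (f := fun p : EuclideanSpace ℝ (Fin d) × Z => (p.1 + (m : ℝ)⁻¹ • e, p.2))
          (by fun_prop)
      exact (h1.sub hf).const_smul (m : ℝ)
    · have h1 := ((hfd p.2 p.1).hasGradientAt.hasFDerivAt.lim_real e).comp
        tendsto_natCast_atTop_atTop
      have e1 : (InnerProductSpace.toDual ℝ (EuclideanSpace ℝ (Fin d)))
          (gradient (fun v => f v p.2) p.1) e = (gradient (fun v => f v p.2) p.1) j := by
        rw [InnerProductSpace.toDual_apply_apply, EuclideanSpace.inner_single_right]
        simp
      rw [e1] at h1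
      exact h1
  have : Measurable fun p : EuclideanSpace ℝ (Fin d) × Z =>
      WithLp.toLp 2 fun j => (gradient (fun v => f v p.2) p.1) j :=
    (WithLp.measurable_toLp 2 _).comp (measurable_pi_lambda _ hcoord)
  exact this

theorem measurable_gradient_of_differentiable {R : EuclideanSpace ℝ (Fin d) → ℝ}
    (hR : Differentiable ℝ R) : Measurable (gradient R) := by
  have h := measurable_gradient_with_param (Z := Unit) (f := fun w _ => R w)
    (hR.continuous.measurable.comp measurable_fst) fun _ => hR
  exact h.comp (f := fun w => (w, ())) (by fun_prop)

theorem measurable_sgldStep {f : EuclideanSpace ℝ (Fin d) → Z → ℝ}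
    (hf : Measurable (Function.uncurry f)) (hfd : ∀ z, Differentiable ℝ (fun w => f w z))
    {R : EuclideanSpace ℝ (Fin d) → ℝ} (hR : Differentiable ℝ R) (β η : ℝ) :
    Measurable fun p : Z × EuclideanSpace ℝ (Fin d) × EuclideanSpace ℝ (Fin d) =>
      sgldStep f R β η p.1 p.2.1 p.2.2 := by
  have h1 : Measurable fun p : Z × EuclideanSpace ℝ (Fin d) × EuclideanSpace ℝ (Fin d) =>
      gradient (fun v => f v p.1) p.2.1 :=
    (measurable_gradient_with_param hf hfd).comp
      (f := fun p : Z × EuclideanSpace ℝ (Fin d) × EuclideanSpace ℝ (Fin d) => (p.2.1, p.1))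
      (by fun_prop)
  have h2 : Measurable fun p : Z × EuclideanSpace ℝ (Fin d) × EuclideanSpace ℝ (Fin d) =>
      gradient R p.2.1 := (measurable_gradient_of_differentiable hR).comp (by fun_prop)
  unfold sgldStep
  exact (Measurable.sub (by fun_prop) ((h1.add h2).const_smul η)).add (by fun_prop)

variable {n : ℕ}

theorem measurable_apply_index : Measurable fun p : (Fin n → Z) × Fin n => p.1 p.2 :=
  measurable_from_prod_countable_left fun i => measurable_pi_apply i

theorem measurable_sgldStep_index {f : EuclideanSpace ℝ (Fin d) → Z → ℝ}
    (hf : Measurable (Function.uncurry f)) (hfd : ∀ z, Differentiable ℝ (fun w => f w z))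
    {R : EuclideanSpace ℝ (Fin d) → ℝ} (hR : Differentiable ℝ R) (β η : ℝ) :
    Measurable fun p : ((Fin n → Z) × EuclideanSpace ℝ (Fin d))
        × (Fin n × EuclideanSpace ℝ (Fin d)) =>
      sgldStep f R β η (p.1.1 p.2.1) p.1.2 p.2.2 := by
  have h1 : Measurable fun p : ((Fin n → Z) × EuclideanSpace ℝ (Fin d))
        × (Fin n × EuclideanSpace ℝ (Fin d)) => p.1.1 p.2.1 :=
    measurable_apply_index.comp (f := fun p : ((Fin n → Z) × EuclideanSpace ℝ (Fin d))
        × (Fin n × EuclideanSpace ℝ (Fin d)) => (p.1.1, p.2.1)) (by fun_prop)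
  exact (measurable_sgldStep hf hfd hR β η).comp (f := fun p : ((Fin n → Z) ×
    EuclideanSpace ℝ (Fin d)) × (Fin n × EuclideanSpace ℝ (Fin d)) =>
      (p.1.1 p.2.1, p.1.2, p.2.2)) (by fun_prop)

end Measurability

/-! ### One SGLD round as a Markov kernel. -/

section StepKernel

variable {d n : ℕ} {Z : Type*} [MeasurableSpace Z]

theorem isProbabilityMeasure_uniformOn_univ_fin (hn : 0 < n) :
    IsProbabilityMeasure (uniformOn (Set.univ : Set (Fin n))) :=
  isProbabilityMeasure_uniformOn Set.finite_univ ⟨⟨0, hn⟩, Set.mem_univ _⟩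

theorem integral_uniformOn_univ_fin (hn : 0 < n) (g : Fin n → ℝ) :
    ∫ j, g j ∂uniformOn (Set.univ : Set (Fin n)) = (n : ℝ)⁻¹ * ∑ j, g j := by
  have := isProbabilityMeasure_uniformOn_univ_fin hn
  rw [integral_fintype (Integrable.of_finite), Finset.mul_sum]
  refine Finset.sum_congr rfl fun j _ => ?_
  simp [Measure.real, uniformOn_univ]

/-- The transition kernel of one SGLD round, as a function of the data set and of the current
point. -/
noncomputable def sgldKernel (n : ℕ) (f : EuclideanSpace ℝ (Fin d) → Z → ℝ)
    (R : EuclideanSpace ℝ (Fin d) → ℝ) (β η : ℝ) :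
    Kernel ((Fin n → Z) × EuclideanSpace ℝ (Fin d)) (EuclideanSpace ℝ (Fin d)) :=
  (Kernel.id ×ₖ Kernel.const _ ((uniformOn (Set.univ : Set (Fin n))).prod
    (stdGaussian (EuclideanSpace ℝ (Fin d))))).map
      fun p => sgldStep f R β η (p.1.1 p.2.1) p.1.2 p.2.2

variable {f : EuclideanSpace ℝ (Fin d) → Z → ℝ} {R : EuclideanSpace ℝ (Fin d) → ℝ}

theorem sgldKernel_apply (hn : 0 < n) (hf : Measurable (Function.uncurry f))
    (hfd : ∀ z, Differentiable ℝ (fun w => f w z)) (hR : Differentiable ℝ R) (β η : ℝ)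
    (S : Fin n → Z) (w : EuclideanSpace ℝ (Fin d)) :
    sgldKernel n f R β η (S, w) = ((uniformOn (Set.univ : Set (Fin n))).prod
      (stdGaussian (EuclideanSpace ℝ (Fin d)))).map
        fun q => sgldStep f R β η (S q.1) w q.2 := by
  have := isProbabilityMeasure_uniformOn_univ_fin hn
  have hm := measurable_sgldStep_index (n := n) hf hfd hR β η
  rw [sgldKernel, Kernel.map_apply _ hm, Kernel.prod_apply, Kernel.id_apply, Kernel.const_apply,
    Measure.dirac_prod, Measure.map_map hm (by fun_prop)]
  rfl

theorem isMarkovKernel_sgldKernel (hn : 0 < n) (hf : Measurable (Function.uncurry f))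
    (hfd : ∀ z, Differentiable ℝ (fun w => f w z)) (hR : Differentiable ℝ R) (β η : ℝ) :
    IsMarkovKernel (sgldKernel n f R β η) := by
  have := isProbabilityMeasure_uniformOn_univ_fin hn
  exact Kernel.IsMarkovKernel.map _ (measurable_sgldStep_index (n := n) hf hfd hR β η)

theorem integral_sgldKernel (hn : 0 < n) (hf : Measurable (Function.uncurry f))
    (hfd : ∀ z, Differentiable ℝ (fun w => f w z)) (hR : Differentiable ℝ R) (β η : ℝ)
    (S : Fin n → Z) (w : EuclideanSpace ℝ (Fin d)) {φ : EuclideanSpace ℝ (Fin d) → ℝ}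
    (hφ : Measurable φ) {M : ℝ} (hM : ∀ x, |φ x| ≤ M) :
    ∫ x, φ x ∂sgldKernel n f R β η (S, w) = (n : ℝ)⁻¹ * ∑ j,
      ∫ ξ, φ (sgldStep f R β η (S j) w ξ) ∂stdGaussian (EuclideanSpace ℝ (Fin d)) := by
  have := isProbabilityMeasure_uniformOn_univ_fin hn
  have hm : Measurable fun q : Fin n × EuclideanSpace ℝ (Fin d) =>
      sgldStep f R β η (S q.1) w q.2 :=
    (measurable_sgldStep_index (n := n) hf hfd hR β η).comp (f := fun q => ((S, w), q))
      (by fun_prop)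
  rw [sgldKernel_apply hn hf hfd hR, integral_map hm.aemeasurable (by fun_prop),
    integral_prod (fun q : Fin n × EuclideanSpace ℝ (Fin d) =>
      φ (sgldStep f R β η (S q.1) w q.2)), integral_uniformOn_univ_fin hn]
  exact integrable_of_abs_le (hφ.comp hm) fun q => hM _

theorem isProbabilityMeasure_sgldLaw (hn : 0 < n) (hf : Measurable (Function.uncurry f))
    (hfd : ∀ z, Differentiable ℝ (fun w => f w z)) (hR : Differentiable ℝ R) (β σ₀ : ℝ)
    (η : ℕ → ℝ) (S : Fin n → Z) (k : ℕ) : IsProbabilityMeasure (sgldLaw f R β σ₀ η S k) := by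
  have := isProbabilityMeasure_uniformOn_univ_fin hn
  induction k with
  | zero => exact Measure.isProbabilityMeasure_map (by fun_prop)
  | succ k ih =>
    refine Measure.isProbabilityMeasure_map (Measurable.aemeasurable ?_)
    exact (measurable_sgldStep_index (n := n) hf hfd hR β (η (k + 1))).comp
      (f := fun p : EuclideanSpace ℝ (Fin d) × Fin n × EuclideanSpace ℝ (Fin d) =>
        ((S, p.1), p.2)) (by fun_prop)

theorem sgldLaw_succ (hn : 0 < n) (hf : Measurable (Function.uncurry f))
    (hfd : ∀ z, Differentiable ℝ (fun w => f w z)) (hR : Differentiable ℝ R) (β σ₀ : ℝ)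
    (η : ℕ → ℝ) (S : Fin n → Z) (k : ℕ) :
    sgldLaw f R β σ₀ η S (k + 1)
      = (sgldLaw f R β σ₀ η S k).bind ((sgldKernel n f R β (η (k + 1))).sectR S) := by
  have := isProbabilityMeasure_uniformOn_univ_fin hn
  have := isProbabilityMeasure_sgldLaw hn hf hfd hR β σ₀ η S k
  have hm : Measurable fun p : EuclideanSpace ℝ (Fin d) × Fin n × EuclideanSpace ℝ (Fin d) =>
      sgldStep f R β (η (k + 1)) (S p.2.1) p.1 p.2.2 :=
    (measurable_sgldStep_index (n := n) hf hfd hR β (η (k + 1))).comp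
      (f := fun p : EuclideanSpace ℝ (Fin d) × Fin n × EuclideanSpace ℝ (Fin d) =>
        ((S, p.1), p.2)) (by fun_prop)
  ext A hA
  rw [sgldLaw, Measure.map_apply hm hA, Measure.prod_apply (hm hA),
    Measure.bind_apply hA (Kernel.aemeasurable _)]
  refine lintegral_congr fun w => ?_
  rw [Kernel.sectR_apply, sgldKernel_apply hn hf hfd hR]
  exact (Measure.map_apply (hm.comp (f := fun q => (w, q)) (by fun_prop)) hA).symm

theorem measurable_sgldLaw (hn : 0 < n) (hf : Measurable (Function.uncurry f))
    (hfd : ∀ z, Differentiable ℝ (fun w => f w z)) (hR : Differentiable ℝ R) (β σ₀ : ℝ)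
    (η : ℕ → ℝ) (k : ℕ) : Measurable fun S : Fin n → Z => sgldLaw f R β σ₀ η S k := by
  induction k with
  | zero => exact measurable_const
  | succ k ih =>
    let Λ : Kernel (Fin n → Z) (EuclideanSpace ℝ (Fin d)) :=
      ⟨fun S => sgldLaw f R β σ₀ η S k, ih⟩
    have : IsMarkovKernel Λ := ⟨fun S => isProbabilityMeasure_sgldLaw hn hf hfd hR β σ₀ η S k⟩
    refine Measure.measurable_of_measurable_coe _ fun A hA => ?_
    simp_rw [sgldLaw_succ hn hf hfd hR, Measure.bind_apply hA (Kernel.aemeasurable _),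
      Kernel.sectR_apply]
    exact ((sgldKernel n f R β (η (k + 1))).measurable_coe hA).lintegral_kernel_prod_right'
      (κ := Λ)

/-- Only the summand of index `i` survives, with weight `1 / n`; this needs no bound on step size or
gradients. -/
theorem tvDistLE_sgldKernel (hn : 0 < n) (hf : Measurable (Function.uncurry f))
    (hfd : ∀ z, Differentiable ℝ (fun w => f w z)) (hR : Differentiable ℝ R) (β η : ℝ)
    {S S' : Fin n → Z} {i : Fin n} (hS : ∀ j ≠ i, S j = S' j) (w : EuclideanSpace ℝ (Fin d)) :
    TVDistLE (sgldKernel n f R β η (S, w)) (sgldKernel n f R β η (S', w)) (1 / n) := by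
  intro l hl hb
  rw [integral_sgldKernel hn hf hfd hR β η S w hl hb,
    integral_sgldKernel hn hf hfd hR β η S' w hl hb, ← mul_sub, ← Finset.sum_sub_distrib, Finset.sum_eq_single i]
  · have h1 : ∀ z, |∫ ξ, l (sgldStep f R β η z w ξ) ∂stdGaussian (EuclideanSpace ℝ (Fin d))| ≤ 1 :=
      fun z => abs_integral_le_of_abs_le fun ξ => hb _
    have hn' : (0 : ℝ) < n := by exact_mod_cast hn
    rw [abs_mul, abs_of_pos (inv_pos.2 hn')]
    have := (abs_sub _ _).trans (add_le_add (h1 (S i)) (h1 (S' i)))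
    calc _ ≤ (n : ℝ)⁻¹ * (1 + 1) := by gcongr
      _ = _ := by ring
  · intro j _ hj
    rw [hS j hj, sub_self]
  · simp

theorem affinityDefectLE_sgldKernel (hn : 0 < n) (hf : Measurable (Function.uncurry f))
    (hfd : ∀ z, Differentiable ℝ (fun w => f w z)) (hR : Differentiable ℝ R) {L β η : ℝ}
    (hL : ∀ w z z', ‖gradient (fun v => f v z) w - gradient (fun v => f v z') w‖ ≤ L)
    (hβ : 0 < β) (hη : 0 < η) (hηL : η * (β * L ^ 2) ≤ Real.log 2)
    {S S' : Fin n → Z} {i : Fin n} (hS : ∀ j ≠ i, S j = S' j) (w : EuclideanSpace ℝ (Fin d)) :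
    AffinityDefectLE (sgldKernel n f R β η (S, w)) (sgldKernel n f R β η (S', w))
      (η * (β * L ^ 2) / (4 * n ^ 2)) := by
  intro φ hφ m M hm hmφ hφM
  set s := √(2 * η / β) with hs_def
  have hs : 0 < s := Real.sqrt_pos.2 (by positivity)
  have hs2 : s ^ 2 = 2 * η / β := Real.sq_sqrt (by positivity)
  -- Measured in units of the noise scale `s`, the data-dependent drift is a translation of the
  -- Gaussian. The common drift and the scaling go into the test function `φ'`.
  let h : Z → EuclideanSpace ℝ (Fin d) := fun z => (-(η / s)) • gradient (fun v => f v z) w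
  have hdist : ∀ z z', ‖h z - h z'‖ ^ 2 ≤ η * (β * L ^ 2) / 2 := by
    intro z z'
    have e : h z - h z' =
        (-(η / s)) • (gradient (fun v => f v z) w - gradient (fun v => f v z') w) := by
      simp only [h, smul_sub]
    rw [e, norm_smul, mul_pow, norm_neg, Real.norm_eq_abs, sq_abs, div_pow, hs2]
    calc _ ≤ η ^ 2 / (2 * η / β) * L ^ 2 := by
          gcongr
          exact hL w z z'
      _ = _ := by field_simp
  let φ' : EuclideanSpace ℝ (Fin d) → ℝ := fun ξ => φ (w - η • gradient R w + s • ξ)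
  have hstep : ∀ z ξ, sgldStep f R β η z w ξ = w - η • gradient R w + s • (ξ + h z) := by
    intro z ξ
    have e : s • h z = -(η • gradient (fun v => f v z) w) := by
      simp only [h, smul_smul, ← neg_smul]
      congr 1
      field_simp
    rw [sgldStep, smul_add, smul_add, e, ← hs_def]
    abel
  have key := one_sub_le_mixture_mul_mixture hn (h := fun j => h (S j)) (h' := fun j => h (S' j)) i
    (fun j hj => by rw [hS j hj]) (r := η * (β * L ^ 2) / 2) (by linarith)
    (fun j k => hdist _ _) (fun j k => hdist _ _) (fun j k => hdist _ _)
    (φ := φ') (hφ.comp (by fun_prop)) hm (fun _ => hmφ _) (fun _ => hφM _)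
  rw [integral_sgldKernel hn hf hfd hR β η S w hφ (abs_le_of_pos_le hm hmφ hφM),
    integral_sgldKernel hn hf hfd hR β η S' w (φ := fun x => (φ x)⁻¹) (by fun_prop)
      (abs_inv_le_inv hm hmφ)]
  simp_rw [hstep]
  convert key using 2
  ring

end StepKernel

/-! ### Total variation stability of the whole run. -/

section Stability

variable {d n : ℕ} {Z : Type*} [MeasurableSpace Z]
  {f : EuclideanSpace ℝ (Fin d) → Z → ℝ} {R : EuclideanSpace ℝ (Fin d) → ℝ}

theorem TVDistLE.mono {X : Type*} [MeasurableSpace X] {μ ν : Measure X} {ε ε' : ℝ}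
    (h : TVDistLE μ ν ε) (hε : ε ≤ ε') : TVDistLE μ ν ε' := fun l hl hb =>
  (h l hl hb).trans (by linarith)

theorem tvDistLE_sgldLaw_div (hn : 0 < n) (hf : Measurable (Function.uncurry f))
    (hfd : ∀ z, Differentiable ℝ (fun w => f w z)) (hR : Differentiable ℝ R) (β σ₀ : ℝ)
    (η : ℕ → ℝ) {S S' : Fin n → Z} {i : Fin n} (hS : ∀ j ≠ i, S j = S' j) (k : ℕ) :
    TVDistLE (sgldLaw f R β σ₀ η S k) (sgldLaw f R β σ₀ η S' k) (k / n) := by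
  induction k with
  | zero => simpa [sgldLaw] using TVDistLE.refl _
  | succ k ih =>
    have := isProbabilityMeasure_sgldLaw hn hf hfd hR β σ₀ η S k
    have := isProbabilityMeasure_sgldLaw hn hf hfd hR β σ₀ η S' k
    have := isMarkovKernel_sgldKernel (n := n) hn hf hfd hR β (η (k + 1))
    rw [sgldLaw_succ hn hf hfd hR, sgldLaw_succ hn hf hfd hR]
    refine (ih.comp (ε' := 1 / n) fun w => ?_).mono (by push_cast; rw [add_div])
    rw [Kernel.sectR_apply, Kernel.sectR_apply]
    exact tvDistLE_sgldKernel hn hf hfd hR β _ hS w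

/-- Uniform stability of SGLD in total variation: changing one data point moves the law of the
last iterate by at most the probability of using that point in the first `k₀` rounds, plus a
Hellinger-type term for the later rounds. -/
theorem tvDistLE_sgldLaw (hn : 0 < n) (hf : Measurable (Function.uncurry f))
    (hfd : ∀ z, Differentiable ℝ (fun w => f w z)) (hR : Differentiable ℝ R) {L β : ℝ}
    (hL : ∀ w z z', ‖gradient (fun v => f v z) w - gradient (fun v => f v z') w‖ ≤ L)
    (σ₀ : ℝ) (hβ : 0 < β) {N : ℕ} {η : ℕ → ℝ} (hη : ∀ k, 1 ≤ k → k ≤ N → 0 < η k) (k₀ : ℕ)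
    (hk₀ : ∀ k, k₀ < k → k ≤ N → η k * (β * L ^ 2) ≤ Real.log 2)
    {S S' : Fin n → Z} {i : Fin n} (hS : ∀ j ≠ i, S j = S' j) :
    TVDistLE (sgldLaw f R β σ₀ η S N) (sgldLaw f R β σ₀ η S' N)
      (k₀ / n + √(∑ k ∈ Finset.Ioc k₀ N, η k * (β * L ^ 2) / (4 * n ^ 2))) := by
  have hn1 : (1 : ℝ) ≤ n := by exact_mod_cast hn
  rcases le_total N k₀ with hN | hN
  · refine (tvDistLE_sgldLaw_div hn hf hfd hR β σ₀ η hS N).mono ?_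
    rw [Finset.Ioc_eq_empty (by omega), Finset.sum_empty, Real.sqrt_zero, add_zero]
    gcongr
  -- Here `ρ` is the hybrid law. It follows the kernels of `S` after round `k₀`, so its distance to
  -- the run on `S` stays at `k₀ / n`, while it loses affinity only to the run on `S'`.
  have key : ∀ k, k₀ ≤ k → k ≤ N → ∃ ρ : Measure (EuclideanSpace ℝ (Fin d)),
      IsProbabilityMeasure ρ ∧ TVDistLE (sgldLaw f R β σ₀ η S k) ρ (k₀ / n) ∧
      AffinityDefectLE ρ (sgldLaw f R β σ₀ η S' k)
        (∑ k ∈ Finset.Ioc k₀ k, η k * (β * L ^ 2) / (4 * n ^ 2)) := by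
    intro k hk
    induction k, hk using Nat.le_induction with
    | base =>
      intro _
      have := isProbabilityMeasure_sgldLaw hn hf hfd hR β σ₀ η S' k₀
      refine ⟨sgldLaw f R β σ₀ η S' k₀, this, tvDistLE_sgldLaw_div hn hf hfd hR β σ₀ η hS k₀, ?_⟩
      simpa using AffinityDefectLE.refl _
    | succ k hk ih =>
      intro hkN
      obtain ⟨ρ, hρ, h1, h2⟩ := ih (by omega)
      have := isProbabilityMeasure_sgldLaw hn hf hfd hR β σ₀ η S k
      have := isProbabilityMeasure_sgldLaw hn hf hfd hR β σ₀ η S' k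
      have := isMarkovKernel_sgldKernel (n := n) hn hf hfd hR β (η (k + 1))
      have hηk := hη (k + 1) (by omega) hkN
      refine ⟨ρ.bind ((sgldKernel n f R β (η (k + 1))).sectR S), inferInstance, ?_, ?_⟩
      · rw [sgldLaw_succ hn hf hfd hR]
        have h3 := h1.comp (κ := (sgldKernel n f R β (η (k + 1))).sectR S)
          (κ' := (sgldKernel n f R β (η (k + 1))).sectR S) fun w => TVDistLE.refl _
        rwa [add_zero] at h3
      · rw [sgldLaw_succ hn hf hfd hR, ← Finset.insert_Ioc_right_eq_Ioc_add_one hk,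
          Finset.sum_insert (by simp), add_comm (_ / _)]
        refine h2.comp (κ := (sgldKernel n f R β (η (k + 1))).sectR S)
          (κ' := (sgldKernel n f R β (η (k + 1))).sectR S') (fun w => ?_)
          (Finset.sum_nonneg fun j hj => ?_) (by positivity) ?_
        · rw [Kernel.sectR_apply, Kernel.sectR_apply]
          exact affinityDefectLE_sgldKernel hn hf hfd hR hL hβ hηk
            (hk₀ (k + 1) (by omega) hkN) hS w
        · rw [Finset.mem_Ioc] at hj
          have := hη j (by omega) (by omega)
          positivity
        · rw [div_le_one (by positivity)]
          have := hk₀ (k + 1) (by omega) hkN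
          nlinarith [Real.log_two_lt_d9]
  obtain ⟨ρ, hρ, h1, h2⟩ := key N hN le_rfl
  have := isProbabilityMeasure_sgldLaw hn hf hfd hR β σ₀ η S' N
  exact h1.trans h2.tvDistLE

end Stability

/-! ### From uniform stability to expected generalization. -/

section Generalization

variable {n : ℕ} {W Z : Type*} [MeasurableSpace W] [MeasurableSpace Z]

theorem measurePreserving_update_pi_prod (D : Measure Z) [IsProbabilityMeasure D] (i : Fin n) :
    MeasurePreserving (fun p : (Fin n → Z) × Z => Function.update p.1 i p.2)
      ((Measure.pi fun _ : Fin n => D).prod D) (Measure.pi fun _ : Fin n => D) := by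
  have hm : Measurable fun p : (Fin n → Z) × Z => Function.update p.1 i p.2 := by fun_prop
  refine ⟨hm, (Measure.pi_eq fun s hs => ?_).symm⟩
  rw [Measure.map_apply hm (MeasurableSet.univ_pi hs)]
  have e : (fun p : (Fin n → Z) × Z => Function.update p.1 i p.2) ⁻¹' Set.univ.pi s
      = (Set.univ.pi (Function.update s i Set.univ)) ×ˢ s i := by
    ext ⟨S, z⟩
    simp only [Set.mem_preimage, Set.mem_univ_pi, Set.mem_prod]
    constructor
    · intro h
      refine ⟨fun j => ?_, by simpa using h i⟩
      rcases eq_or_ne j i with rfl | hj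
      · simp
      · simpa [hj] using h j
    · rintro ⟨h1, h2⟩ j
      rcases eq_or_ne j i with rfl | hj
      · simpa using h2
      · simpa [hj] using h1 j
  rw [e, Measure.prod_prod, Measure.pi_pi, ← Finset.mul_prod_erase _ _ (Finset.mem_univ i),
    ← Finset.mul_prod_erase _ (fun j => D (s j)) (Finset.mem_univ i), Function.update_self,
    measure_univ, one_mul, mul_comm]
  congr 1
  refine Finset.prod_congr rfl fun j hj => ?_
  rw [Function.update_of_ne (Finset.ne_of_mem_erase hj)]

/-- On average, the generalization error of a uniformly stable randomized algorithm with bounded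
loss is at most its stability constant. -/
theorem integral_genErr_le_of_uniformStability (hn : 0 < n) (D : Measure Z)
    [IsProbabilityMeasure D] {l : W → Z → ℝ} (hl : Measurable (Function.uncurry l)) {C : ℝ}
    (hC : ∀ w z, |l w z| ≤ C) (A : Kernel (Fin n → Z) W) [IsMarkovKernel A] {b : ℝ}
    (hb : ∀ S i z, ∫ w, l w z ∂A S - ∫ w, l w z ∂A (Function.update S i z) ≤ b) :
    Integrable (fun S => genErr l D S (A S)) (Measure.pi fun _ : Fin n => D) ∧
      ∫ S, genErr l D S (A S) ∂(Measure.pi fun _ : Fin n => D) ≤ b := by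
  set P : Measure (Fin n → Z) := Measure.pi fun _ : Fin n => D with hP
  have hlz : ∀ z, Measurable fun w => l w z := fun z => hl.comp (f := fun w => (w, z)) (by fun_prop)
  have hn' : (0 : ℝ) < n := by exact_mod_cast hn
  let a : (Fin n → Z) × Z → ℝ := fun p => ∫ w, l w p.2 ∂A p.1
  have ha : Measurable a := by
    have h1 : Measurable fun q : ((Fin n → Z) × Z) × W => l q.2 q.1.2 :=
      hl.comp (f := fun q : ((Fin n → Z) × Z) × W => (q.2, q.1.2)) (by fun_prop)
    exact (h1.stronglyMeasurable.integral_kernel_prod_right'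
      (κ := A.prodMkRight Z)).measurable
  have hab : ∀ p, |a p| ≤ C := fun p => abs_integral_le_of_abs_le fun w => hC w p.2
  have hpop : Measurable fun S => ∫ z, a (S, z) ∂D :=
    ha.stronglyMeasurable.integral_prod_right'.measurable
  have hpopb : ∀ S, |∫ z, a (S, z) ∂D| ≤ C := fun S => abs_integral_le_of_abs_le fun z => hab _
  have hemp : ∀ i, Measurable fun S : Fin n → Z => a (S, S i) := fun i =>
    ha.comp (f := fun S : Fin n → Z => (S, S i)) (by fun_prop)
  have hempi : ∀ i, Integrable (fun S : Fin n → Z => a (S, S i)) P := fun i =>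
    integrable_of_abs_le (hemp i) fun S => hab _
  have hpopi : Integrable (fun S => ∫ z, a (S, z) ∂D) P := integrable_of_abs_le hpop hpopb
  have hgen : (fun S => genErr l D S (A S))
      = fun S => ∫ z, a (S, z) ∂D - (n : ℝ)⁻¹ * ∑ i, a (S, S i) := by
    funext S
    have i1 : Integrable (fun w => ∫ z, l w z ∂D) (A S) :=
      integrable_of_abs_le hl.stronglyMeasurable.integral_prod_right.measurable
        fun w => abs_integral_le_of_abs_le fun z => hC w z
    have i2 : ∀ i, Integrable (fun w => l w (S i)) (A S) := fun i =>
      integrable_of_abs_le (hlz _) fun w => hC w _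
    rw [genErr, integral_sub i1 ((integrable_finsetSum _ fun i _ => i2 i).const_mul _),
      integral_const_mul, integral_finsetSum _ fun i _ => i2 i, one_div,
      integral_integral_swap (integrable_of_abs_le hl fun p => hC p.1 p.2)]
  have hsum : Integrable (fun S => (n : ℝ)⁻¹ * ∑ i, a (S, S i)) P :=
    (integrable_finsetSum _ fun i _ => hempi i).const_mul _
  rw [hgen]
  refine ⟨hpopi.sub hsum, ?_⟩
  have ia : Integrable a (P.prod D) := integrable_of_abs_le ha hab
  have hupd : ∀ i, Measurable fun p : (Fin n → Z) × Z => a (Function.update p.1 i p.2, p.2) :=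
    fun i => ha.comp (f := fun p : (Fin n → Z) × Z => (Function.update p.1 i p.2, p.2))
      (by fun_prop)
  -- Resampling coordinate `i` makes the training point `S i` a fresh `z`. The empirical term then
  -- becomes the loss at `z` after training on the modified sample, and `hb` applies pointwise.
  have hres : ∀ i, ∫ S, ∫ z, a (S, z) ∂D ∂P - b ≤ ∫ S, a (S, S i) ∂P := by
    intro i
    have hmp := measurePreserving_update_pi_prod D i
    have e : ∫ S, a (S, S i) ∂P = ∫ p, a (Function.update p.1 i p.2, p.2) ∂(P.prod D) := by
      have h1 := integral_map (μ := P.prod D) (f := fun S : Fin n → Z => a (S, S i))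
        hmp.measurable.aemeasurable (hemp i).aestronglyMeasurable
      rw [hP] at h1 ⊢
      rw [hmp.map_eq] at h1
      simpa using h1
    rw [e, ← integral_prod a ia, sub_le_comm,
      ← integral_sub ia (integrable_of_abs_le (hupd i) fun p => hab _)]
    exact integral_le_of_forall_le (ia.sub (integrable_of_abs_le (hupd i) fun p => hab _))
      fun p => hb p.1 i p.2
  rw [integral_sub hpopi hsum, integral_const_mul, integral_finsetSum _ fun i _ => hempi i]
  have h1 : ∑ i : Fin n, (∫ S, ∫ z, a (S, z) ∂D ∂P - b) ≤ ∑ i : Fin n, ∫ S, a (S, S i) ∂P :=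
    Finset.sum_le_sum fun i _ => hres i
  rw [Finset.sum_const, Finset.card_univ, Fintype.card_fin, nsmul_eq_mul] at h1
  have h2 := mul_le_mul_of_nonneg_left h1 (inv_pos.2 hn').le
  rw [← mul_assoc, inv_mul_cancel₀ hn'.ne', one_mul] at h2
  linarith

end Generalization

/-! ### The generalization bound. -/

theorem theorem8 {d n : ℕ} (hn : 0 < n)
    {Z : Type*} [MeasurableSpace Z] (D : Measure Z) [IsProbabilityMeasure D]
    -- the objective and the regularizer
    (f : EuclideanSpace ℝ (Fin d) → Z → ℝ) (hf : Measurable (Function.uncurry f))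
    (hfd : ∀ z, Differentiable ℝ (fun w => f w z))
    (R : EuclideanSpace ℝ (Fin d) → ℝ) (hR : Differentiable ℝ R)
    -- gradients of the objective at different data points differ by at most `L`
    (L : ℝ)
    (hL : ∀ w z z', ‖gradient (fun v => f v z) w - gradient (fun v => f v z') w‖ ≤ L)
    -- the loss, bounded by `C`
    (l : EuclideanSpace ℝ (Fin d) → Z → ℝ) (hl : Measurable (Function.uncurry l))
    (C : ℝ) (hC : ∀ w z, |l w z| ≤ C)
    -- `N` rounds of SGLD with inverse temperature `β` and step sizes `η 1, …, η N`
    (β σ₀ : ℝ) (hβ : 0 < β) (N : ℕ) (η : ℕ → ℝ) (hη : ∀ k, 1 ≤ k → k ≤ N → 0 < η k)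
    -- the step sizes after the round `k₀` are at most `ln 2 / (β L²)`
    (k₀ : ℕ) (hk₀ : ∀ k, k₀ < k → k ≤ N → η k * (β * L ^ 2) ≤ Real.log 2) :
    Integrable (fun S : Fin n → Z => genErr l D S (sgldLaw f R β σ₀ η S N))
        (Measure.pi fun _ : Fin n => D) ∧
      ∫ S : Fin n → Z, genErr l D S (sgldLaw f R β σ₀ η S N) ∂(Measure.pi fun _ : Fin n => D)
        ≤ 2 * C * k₀ / n
          + Real.sqrt β * L * C / n * Real.sqrt (∑ k ∈ Finset.Ioc k₀ N, η k) := by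
  have hC0 : 0 ≤ C := by
    obtain ⟨z⟩ := D.nonempty_of_neZero
    exact (abs_nonneg _).trans (hC 0 z)
  have hL0 : 0 ≤ L := by
    obtain ⟨z⟩ := D.nonempty_of_neZero
    exact (norm_nonneg _).trans (hL 0 z z)
  let A : Kernel (Fin n → Z) (EuclideanSpace ℝ (Fin d)) :=
    ⟨fun S => sgldLaw f R β σ₀ η S N, measurable_sgldLaw hn hf hfd hR β σ₀ η N⟩
  have : IsMarkovKernel A := ⟨fun S => isProbabilityMeasure_sgldLaw hn hf hfd hR β σ₀ η S N⟩
  refine integral_genErr_le_of_uniformStability hn D hl hC A fun S i z => ?_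
  have hS : ∀ j ≠ i, S j = Function.update S i z j := fun j hj =>
    (Function.update_of_ne hj _ _).symm
  have h1 := (tvDistLE_sgldLaw hn hf hfd hR hL σ₀ hβ hη k₀ hk₀ hS).abs_integral_sub_le
    (l := fun w => l w z) (hl.comp (f := fun w => (w, z)) (by fun_prop)) (fun w => hC w z) hC0
  refine (le_abs_self _).trans (h1.trans_eq ?_)
  -- The root of this sum carries the factor `√β * L / (2 * n)`, whose `2` cancels against the `2 *
  -- C` from passing to integrals of the loss.
  have e : ∑ k ∈ Finset.Ioc k₀ N, η k * (β * L ^ 2) / (4 * (n : ℝ) ^ 2)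
      = β * (L / (2 * n)) ^ 2 * ∑ k ∈ Finset.Ioc k₀ N, η k := by
    rw [Finset.mul_sum]
    refine Finset.sum_congr rfl fun k _ => ?_
    rw [div_pow]
    ring
  rw [e, Real.sqrt_mul (by positivity), Real.sqrt_mul hβ.le, Real.sqrt_sq (by positivity)]
  field_simp
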